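/- **Theorem (Barbells).** For a finite graph $G$, let $X_G=\sum_{\kappa}\prod_{v\in V(G)}x_{\kappa(v)}$ be its chromatic symmetric function in the indeterminates $x_1,x_2,\dots$, where $\kappa$ runs over the proper colorings of $G$ by positive integers. For a composition $I=i_1i_2\cdots i_s\vDash n$ (a sequence of positive integers with sum $n$) write $i_{-1}=i_s$ for its last part, $e_I=e_{i_1}e_{i_2}\cdots e_{i_s}$ for the product of elementary symmetric functions, and $w_I=i_1\prod_{j\ge 2}(i_j-1)$. Let $n=a+b+c$ where $a\ge 1$ and $b,c\ge 0$ are integers, and put $(k_1,\dots,k_{b+2})=(a,1,\dots,1,c)$ with $b$ ones. The barbell $K(a1^bc)$ is the graph whose vertex set is the disjoint union of sets $V_j=\{v_{j1},\dots,v_{jk_j}\}$, $1\le j\le b+2$, in which two distinct vertices are adjacent if and only if both lie in $V_1$ or both lie in $V_j\cup\{v_{(j-1)k_{j-1}}\}$ for some $j\ge 2$. (Thus a clique $K_a$ and a clique $K_{c+1}$ are joined by a path with $b$ edges; for $c=0$ the last set is empty and the graph is a lollipop.) Then $$ X_{K(a1^bc)}=(a-1)!\,c!\left[\sum_{\substack{I\vDash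 n,\ i_{-1}\ge a\\ i_1\ge c+1}}w_I\,e_I+\sum_{\substack{I\vDash n,\ i_{-1}\ge a\\ i_1\le c<i_2}}(i_2-i_1)\prod_{j\ge 3}(i_j-1)\,e_I\right], $$ where the second sum is over compositions with at least two parts. -/

import Mathlib

noncomputable section

/-- The vertices of the `K`-chain of a sequence `I = i₁ i₂ ⋯ iₛ`: the disjoint union of sets
`V₁, …, Vₛ` with `|V_j| = i_j` (positions are numbered from `0`). -/
abbrev KChainVertex (I : List ℕ) : Type :=
  (j : Fin I.length) × Fin (I.get j)

/-- The `j`-th clique of the `K`-chain: the block `V_j` together with the last vertex of the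
preceding block (for the first `j` there is no preceding block, and the clique is `V_j`). -/
def kChainClique (I : List ℕ) (j : Fin I.length) : Set (KChainVertex I) :=
  {v | v.1 = j ∨ ((v.1 : ℕ) + 1 = j ∧ (v.2 : ℕ) + 1 = I.get v.1)}

/-- The `K`-chain `K(I)`: two distinct vertices are adjacent iff they lie in a common clique. -/
def kChain (I : List ℕ) : SimpleGraph (KChainVertex I) where
  Adj u v := u ≠ v ∧ ∃ j, u ∈ kChainClique I j ∧ v ∈ kChainClique I j
  symm := ⟨fun _ _ h => ⟨h.1.symm, h.2.imp fun _ hj => hj.symm⟩⟩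
  loopless := ⟨fun _ h => h.1 rfl⟩

/-- The barbell `K(a 1ᵇ c)`. For `c = 0` the last block is empty and contributes neither vertices
nor edges, so that this is the lollipop `K(a 1ᵇ)`. -/
def barbell (a b c : ℕ) : SimpleGraph (KChainVertex (a :: (List.replicate b 1 ++ [c]))) :=
  kChain (a :: (List.replicate b 1 ++ [c]))

/-- The chromatic symmetric function `X_G = ∑_κ ∏_v x_{κ(v)}` of a finite graph, as a formal power
series in countably many indeterminates: the coefficient of the monomial `x^d` is the number of
proper colourings `κ` with `∏_v x_{κ(v)} = x^d`. -/
def chromaticSymm {V : Type*} [Fintype V] (G : SimpleGraph V) : MvPowerSeries ℕ ℚ :=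
  fun d => (Nat.card {κ : G.Coloring ℕ // ∑ v, Finsupp.single (κ v) 1 = d} : ℚ)

/-- There are finitely many colourings to count, so `Nat.card` above is the true number. -/
theorem finite_coloring_of_monomial {V : Type*} [Fintype V] (G : SimpleGraph V) (d : ℕ →₀ ℕ) :
    Finite {κ : G.Coloring ℕ // ∑ v, Finsupp.single (κ v) 1 = d} := by
  have hmem : ∀ κ : {κ : G.Coloring ℕ // ∑ v, Finsupp.single (κ v) 1 = d}, ∀ v,
      κ.1 v ∈ d.support := by
    intro κ v
    have hd := DFunLike.congr_fun κ.2 (κ.1 v)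
    rw [Finsupp.finsetSum_apply] at hd
    rw [Finsupp.mem_support_iff]
    have h := Finset.single_le_sum
      (f := fun w => (Finsupp.single (κ.1 w) 1 : ℕ →₀ ℕ) (κ.1 v))
      (fun _ _ => Nat.zero_le _) (Finset.mem_univ v)
    simp only [Finsupp.single_eq_same] at h
    omega
  refine Finite.of_injective
    (fun κ => fun v => (⟨κ.1 v, hmem κ v⟩ : d.support)) ?_
  intro κ κ' h
  apply Subtype.ext
  apply DFunLike.ext
  intro v
  exact congrArg Subtype.val (congrFun h v)

open Classical in
/-- The elementary symmetric function `e_k`, the sum of all squarefree monomials of degree `k`. -/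
def elemSymm (k : ℕ) : MvPowerSeries ℕ ℚ :=
  fun d => if (∀ i, d i ≤ 1) ∧ d.degree = k then 1 else 0

namespace Composition

variable {n : ℕ}

/-- `e_I = e_{i₁} e_{i₂} ⋯`. -/
def elemSymm (I : Composition n) : MvPowerSeries ℕ ℚ :=
  (I.blocks.map _root_.elemSymm).prod

/-- The part `i_k` (for `k ≥ 1`); it is `0` if there is no such part. -/
def part (I : Composition n) (k : ℕ) : ℕ :=
  I.blocks.getD (k - 1) 0

/-- The last part `i₋₁`; it is `0` if `I` is empty. -/
def lastPart (I : Composition n) : ℕ :=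
  I.blocks.getLastD 0

/-- The product `∏_{j > k} (i_j - 1)`. -/
def prodAfter (I : Composition n) (k : ℕ) : ℚ :=
  ((I.blocks.drop k).map fun i => (i : ℚ) - 1).prod

/-- `w_I = i₁ ∏_{j ≥ 2} (i_j - 1)`. -/
def weight (I : Composition n) : ℚ :=
  I.part 1 * I.prodAfter 1

end Composition

end

/-! In finitely many variables, let P_k(i) be e_k with x_i omitted, let T be the path transfer
operator (Tu)_i = ∑_{l≠i} x_l u_l, and put ⟨u,v⟩ = ∑ x_i u_i v_i. Colouring block by block shows
that the chromatic function is (a-1)! c! S(a-1,b,c), where S(α,b,c) = ⟨P_α, T^b P_c⟩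
(`chainSum_barbell`).

T is self-adjoint, so S is symmetric in its outer arguments. The identity T P_c = P_{c+1} + c
e_{c+1} P_0 (`puncturedSum_succ`) shortens the clique and lengthens the path. With S(α,0,0) = (α+1)
e_{α+1} these facts determine S: a barbell is a lollipop minus multiples of shorter lollipops, and
symmetry reduces lollipops to paths.

It remains to compare e-expansions (`barbellTerms_eq`). For i₁ = k+1 ≤ c and i₂ = l+1, the lollipop
and the correction differ by (k+1)l - k(l+1) = l-k. This is antisymmetric, so terms with both parts
at most c cancel, and those with i₂ > c form the second sum.

Finitely many variables suffice, since the coefficient of x^d only sees the variables in the support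
of d. -/

open Finset

/-! ### Elementary symmetric polynomials on a finite set -/

section ElemSymmOns

variable {ι R : Type*} [DecidableEq ι] [CommRing R]

/-- The elementary symmetric polynomial of degree `k` in the values `x i`, `i ∈ s`. -/
def elemSymmOn (x : ι → R) (k : ℕ) (s : Finset ι) : R :=
  ∑ t ∈ s.powersetCard k, ∏ i ∈ t, x i

theorem elemSymmOn_zero {ι : Type*} (x : ι → R) (s : Finset ι) : elemSymmOn x 0 s = 1 := by
  simp [elemSymmOn]

theorem elemSymmOn_succ_erase (x : ι → R) (k : ℕ) {s : Finset ι} {i : ι} (hi : i ∈ s) :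
    elemSymmOn x (k + 1) s =
      elemSymmOn x (k + 1) (s.erase i) + x i * elemSymmOn x k (s.erase i) := by
  have hi' : i ∉ s.erase i := notMem_erase i s
  have key : ∀ t ∈ (s.erase i).powersetCard k, i ∉ t := fun t ht hit =>
    hi' ((mem_powersetCard.1 ht).1 hit)
  conv_lhs => rw [← insert_erase hi]
  rw [elemSymmOn, powersetCard_succ_insert hi', sum_union, sum_image]
  · congr 1
    rw [elemSymmOn, mul_sum]
    exact sum_congr rfl fun t ht => prod_insert (key t ht)
  · intro t ht u hu h
    rw [← erase_insert (key t ht), ← erase_insert (key u hu)]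
    exact congrArg (fun w => erase w i) h
  · rw [disjoint_left]
    intro t ht hu
    obtain ⟨u, -, rfl⟩ := mem_image.1 hu
    exact hi' ((mem_powersetCard.1 ht).1 (mem_insert_self i u))

/-- Double counting of (k+1)-subsets with a marked element. -/
theorem sum_mul_elemSymmOn_erase (x : ι → R) (k : ℕ) (s : Finset ι) :
    ∑ i ∈ s, x i * elemSymmOn x k (s.erase i) = (k + 1) * elemSymmOn x (k + 1) s := by
  have h : ((k : R) + 1) * elemSymmOn x (k + 1) s =
      ∑ t ∈ s.powersetCard (k + 1), ∑ _i ∈ t, ∏ j ∈ t, x j := by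
    rw [elemSymmOn, mul_sum]
    refine sum_congr rfl fun t ht => ?_
    rw [sum_const, (mem_powersetCard.1 ht).2, nsmul_eq_mul]
    push_cast
    ring
  rw [h]
  simp only [elemSymmOn, mul_sum]
  rw [sum_sigma', sum_sigma']
  refine sum_bij' (fun p _ => ⟨insert p.1 p.2, p.1⟩) (fun p _ => ⟨p.2, p.1.erase p.2⟩) ?_ ?_ ?_ ?_ ?_
  · rintro ⟨i, t⟩ hp
    simp only [mem_sigma, mem_powersetCard] at hp ⊢
    obtain ⟨hi, ht, hc⟩ := hp
    have hit : i ∉ t := fun h => notMem_erase i s (ht h)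
    exact ⟨⟨insert_subset hi (ht.trans (erase_subset i s)), by rw [card_insert_of_notMem hit, hc]⟩,
      mem_insert_self i t⟩
  · rintro ⟨t, i⟩ hp
    simp only [mem_sigma, mem_powersetCard] at hp ⊢
    obtain ⟨⟨ht, hc⟩, hi⟩ := hp
    exact ⟨ht hi, erase_subset_erase i ht, by rw [card_erase_of_mem hi, hc]; rfl⟩
  · rintro ⟨i, t⟩ hp
    simp only [mem_sigma, mem_powersetCard] at hp
    have hit : i ∉ t := fun h => notMem_erase i s (hp.2.1 h)
    simp [erase_insert hit]
  · rintro ⟨t, i⟩ hp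
    simp only [mem_sigma] at hp
    simp [insert_erase hp.2]
  · rintro ⟨i, t⟩ hp
    simp only [mem_sigma, mem_powersetCard] at hp
    have hit : i ∉ t := fun h => notMem_erase i s (hp.2.1 h)
    exact (prod_insert hit).symm

end ElemSymmOns

/-! ### The transfer operator and the recursion for barbells -/

section Transfer

variable {ι R : Type*} [DecidableEq ι] [Fintype ι] [CommRing R]

/-- One step of the transfer operator of a path: the vertex before has another colour. -/
def transferStep (x : ι → R) (u : ι → R) (i : ι) : R :=
  ∑ l ∈ univ.erase i, x l * u l

theorem transferStep_eq (x u : ι → R) (i : ι) :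
    transferStep x u i = ∑ l, x l * u l - x i * u i := by
  rw [transferStep, ← add_sum_erase univ (fun l => x l * u l) (mem_univ i)]
  ring

/-- Self-adjointness: T is a rank-one form minus a diagonal, both symmetric for ∑ x_i u_i v_i. -/
theorem sum_transferStep_mul (x u v : ι → R) :
    ∑ i, x i * u i * transferStep x v i = ∑ i, x i * transferStep x u i * v i := by
  simp only [transferStep_eq, mul_sub, sub_mul, sum_sub_distrib]
  congr 1
  · rw [← sum_mul, mul_comm, sum_mul]
    exact sum_congr rfl fun i _ => by ring
  · exact sum_congr rfl fun i _ => by ring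

theorem sum_iterate_transferStep_mul (x : ι → R) (b : ℕ) (u v : ι → R) :
    ∑ i, x i * u i * (transferStep x)^[b] v i = ∑ i, x i * (transferStep x)^[b] u i * v i := by
  induction b generalizing u with
  | zero => rfl
  | succ b ih =>
    rw [Function.iterate_succ_apply', sum_transferStep_mul, ih, Function.iterate_succ_apply]

theorem transferStep_sub (x u v : ι → R) :
    transferStep x (u - v) = transferStep x u - transferStep x v := by
  funext i
  simp [transferStep, mul_sub]

theorem transferStep_smul (x : ι → R) (r : R) (u : ι → R) :
    transferStep x (r • u) = r • transferStep x u := by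
  funext i
  simp only [transferStep, Pi.smul_apply, smul_eq_mul, mul_sum]
  exact sum_congr rfl fun i _ => by ring

theorem iterate_transferStep_sub (x : ι → R) (b : ℕ) (u v : ι → R) :
    (transferStep x)^[b] (u - v) = (transferStep x)^[b] u - (transferStep x)^[b] v := by
  induction b generalizing u v with
  | zero => rfl
  | succ b ih => simp only [Function.iterate_succ_apply, transferStep_sub, ih]

theorem iterate_transferStep_smul (x : ι → R) (b : ℕ) (r : R) (u : ι → R) :
    (transferStep x)^[b] (r • u) = r • (transferStep x)^[b] u := by
  induction b generalizing u with
  | zero => rfl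
  | succ b ih => simp only [Function.iterate_succ_apply, transferStep_smul, ih]

/-- The elementary symmetric polynomial of degree `k` in all variables but `x i`. -/
def puncturedSum (x : ι → R) (k : ℕ) (i : ι) : R :=
  elemSymmOn x k (univ.erase i)

/-- T P_c(i) is (c+1) e_{c+1} - x_i P_c(i), while x_i P_c(i) = e_{c+1} - P_{c+1}(i); what remains
besides P_{c+1} is the constant c e_{c+1}, written with P_0 = 1. -/
theorem puncturedSum_succ (x : ι → R) (c : ℕ) :
    puncturedSum x (c + 1) = transferStep x (puncturedSum x c) -
      (c * elemSymmOn x (c + 1) univ) • puncturedSum x 0 := by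
  funext i
  have h := elemSymmOn_succ_erase x c (mem_univ i)
  have h' := sum_mul_elemSymmOn_erase x c univ
  simp only [Pi.sub_apply, Pi.smul_apply, smul_eq_mul, transferStep_eq, puncturedSum,
    elemSymmOn_zero]
  linear_combination h' * (-1 : R) - h

/-- The weighted number of colourings of a barbell, up to the permutations of the two cliques. -/
def barbellSum (x : ι → R) (α b c : ℕ) : R :=
  ∑ i, x i * puncturedSum x α i * (transferStep x)^[b] (puncturedSum x c) i

theorem barbellSum_symm (x : ι → R) (α b c : ℕ) : barbellSum x α b c = barbellSum x c b α := by
  rw [barbellSum, sum_iterate_transferStep_mul, barbellSum]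
  exact sum_congr rfl fun i _ => by ring

theorem barbellSum_succ (x : ι → R) (α b c : ℕ) :
    barbellSum x α b (c + 1) = barbellSum x α (b + 1) c -
      c * elemSymmOn x (c + 1) univ * barbellSum x α b 0 := by
  simp only [barbellSum]
  rw [puncturedSum_succ, iterate_transferStep_sub, iterate_transferStep_smul, mul_sum,
    ← sum_sub_distrib]
  refine sum_congr rfl fun i _ => ?_
  simp only [Pi.sub_apply, Pi.smul_apply, smul_eq_mul, Function.iterate_succ_apply]
  ring

theorem barbellSum_zero_zero (x : ι → R) (α : ℕ) :
    barbellSum x α 0 0 = (α + 1) * elemSymmOn x (α + 1) univ := by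
  rw [← sum_mul_elemSymmOn_erase]
  simp [barbellSum, puncturedSum, elemSymmOn_zero]

end Transfer

/-! ### Compositions as lists, split at the first or last part -/

section CompositionLists

/-- The compositions of `n` as lists. -/
def compositionLists (n : ℕ) : Finset (List ℕ) :=
  univ.image (Composition.blocks : Composition n → List ℕ)

theorem mem_compositionLists {n : ℕ} {l : List ℕ} :
    l ∈ compositionLists n ↔ (∀ i ∈ l, 0 < i) ∧ l.sum = n := by
  rw [compositionLists, mem_image]
  constructor
  · rintro ⟨I, -, rfl⟩
    exact ⟨fun i hi => I.blocks_pos hi, I.blocks_sum⟩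
  · rintro ⟨h, hs⟩
    exact ⟨⟨l, fun hi => h _ hi, hs⟩, mem_univ _, rfl⟩

variable {M : Type*} [AddCommMonoid M]

theorem sum_composition (n : ℕ) (F : List ℕ → M) :
    ∑ I : Composition n, F I.blocks = ∑ l ∈ compositionLists n, F l := by
  rw [compositionLists, sum_image]
  exact fun I _ J _ h => Composition.ext h

theorem compositionLists_zero : compositionLists 0 = {[]} := by
  ext l
  rw [mem_compositionLists, mem_singleton]
  constructor
  · rintro ⟨h, hs⟩
    rw [List.eq_nil_iff_forall_not_mem]
    intro i hi
    have := List.sum_eq_zero_iff.1 hs i hi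
    have := h i hi
    omega
  · rintro rfl
    simp

theorem ne_nil_of_mem_compositionLists {n : ℕ} (hn : n ≠ 0) {l : List ℕ}
    (h : l ∈ compositionLists n) : l ≠ [] := by
  rintro rfl
  exact hn (mem_compositionLists.1 h).2.symm

theorem sum_compositionLists_cons (n : ℕ) (F : List ℕ → M) :
    ∑ l ∈ compositionLists (n + 1), F l =
      ∑ k ∈ range (n + 1), ∑ l ∈ compositionLists (n - k), F ((k + 1) :: l) := by
  rw [sum_sigma']
  symm
  refine sum_bij' (fun p _ => (p.1 + 1) :: p.2) (fun l _ => ⟨l.headD 0 - 1, l.tail⟩) ?_ ?_ ?_ ?_ ?_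
  · rintro ⟨k, l⟩ hp
    simp only [mem_sigma, mem_range, mem_compositionLists] at hp ⊢
    obtain ⟨hk, hl, hs⟩ := hp
    refine ⟨?_, by simp only [List.sum_cons]; omega⟩
    rintro i (_ | ⟨_, hi⟩)
    exacts [Nat.succ_pos k, hl i hi]
  · rintro (_ | ⟨k, l⟩) hl
    · simp [mem_compositionLists] at hl
    · simp only [mem_sigma, mem_range, mem_compositionLists, List.headD_cons, List.tail_cons,
        List.sum_cons, List.mem_cons, forall_eq_or_imp] at hl ⊢
      exact ⟨by omega, hl.1.2, by omega⟩
  · rintro ⟨k, l⟩ _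
    simp
  · rintro (_ | ⟨k, l⟩) hl
    · simp [mem_compositionLists] at hl
    · have := (mem_compositionLists.1 hl).1 k (by simp)
      simp only [List.headD_cons, List.tail_cons, List.cons.injEq, and_true]
      omega
  · intros
    rfl

theorem sum_compositionLists_reverse (n : ℕ) (F : List ℕ → M) :
    ∑ l ∈ compositionLists n, F l.reverse = ∑ l ∈ compositionLists n, F l := by
  refine sum_bij' (fun l _ => l.reverse) (fun l _ => l.reverse) ?_ ?_ ?_ ?_ ?_ <;>
    simp [mem_compositionLists]

theorem sum_compositionLists_concat (n : ℕ) (F : List ℕ → M) :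
    ∑ l ∈ compositionLists (n + 1), F l =
      ∑ k ∈ range (n + 1), ∑ l ∈ compositionLists (n - k), F (l ++ [k + 1]) := by
  rw [← sum_compositionLists_reverse, sum_compositionLists_cons]
  refine sum_congr rfl fun k _ => ?_
  rw [← sum_compositionLists_reverse]
  simp

end CompositionLists

/-! ### Solving the recursion in terms of compositions -/

section BarbellExpansion

variable {R : Type*} [CommRing R] (e : ℕ → R)

/-- The product of `(i - 1) e_i` over the parts `i` of a list. -/
def tailTerm (l : List ℕ) : R :=
  (l.map fun i : ℕ => ((i : R) - 1) * e i).prod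

/-- The term `i₁ ∏_{j ≥ 2} (i_j - 1) e_I`. -/
def weightTerm : List ℕ → R
  | [] => 0
  | i :: l => i * e i * tailTerm e l

/-- The term `(i₂ - i₁) ∏_{j ≥ 3} (i_j - 1) e_I`. -/
def exchangeTerm : List ℕ → R
  | i :: j :: l => ((j : R) - i) * e i * e j * tailTerm e l
  | _ => 0

theorem tailTerm_cons (i : ℕ) (l : List ℕ) :
    tailTerm e (i :: l) = ((i : R) - 1) * e i * tailTerm e l := by
  simp [tailTerm]

theorem weightTerm_concat {l : List ℕ} (hl : l ≠ []) (k : ℕ) :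
    weightTerm e (l ++ [k + 1]) = k * e (k + 1) * weightTerm e l := by
  obtain _ | ⟨i, l⟩ := l
  · exact absurd rfl hl
  · simp only [List.cons_append, weightTerm, tailTerm, List.map_append, List.prod_append,
      List.map_cons, List.map_nil, List.prod_singleton]
    push_cast
    ring

/-- The expansion of the lollipop with a clique of size `a` and `n` vertices. -/
def lollipopTerms (a n : ℕ) : R :=
  ∑ l ∈ compositionLists n with a ≤ l.getLastD 0, weightTerm e l

/-- Splits off the last part k+1. The value k = N is the one-part composition; otherwise the rest is
an arbitrary nonempty composition, so the bound on its last part becomes the vacuous 1. -/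
theorem lollipopTerms_succ (α N : ℕ) (h : α ≤ N) :
    lollipopTerms e (α + 1) (N + 1) = (N + 1) * e (N + 1) +
      ∑ k ∈ Ico α N, k * e (k + 1) * lollipopTerms e 1 (N - k) := by
  have hlast : ∀ m, lollipopTerms e 1 (m + 1) = ∑ l ∈ compositionLists (m + 1), weightTerm e l := by
    intro m
    rw [lollipopTerms, filter_true_of_mem]
    intro l hl
    have hne := ne_nil_of_mem_compositionLists (Nat.succ_ne_zero m) hl
    rw [List.getLastD_eq_getLast?, List.getLast?_eq_getLast_of_ne_nil hne]
    exact (mem_compositionLists.1 hl).1 _ (List.getLast_mem hne)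
  have hstep : lollipopTerms e (α + 1) (N + 1) =
      ∑ k ∈ range (N + 1), if α ≤ k then
        ∑ l ∈ compositionLists (N - k), weightTerm e (l ++ [k + 1]) else 0 := by
    rw [lollipopTerms, sum_filter, sum_compositionLists_concat]
    refine sum_congr rfl fun k _ => ?_
    split_ifs with hk
    · exact sum_congr rfl fun l _ => by simp [hk]
    · exact sum_eq_zero fun l _ => by simp [hk]
  rw [hstep, sum_range_succ, if_pos h, Nat.sub_self, compositionLists_zero, sum_singleton,
    add_comm, ← sum_filter]
  congr 1
  · simp [weightTerm, tailTerm]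
  · have : (range N).filter (α ≤ ·) = Ico α N := by
      ext k
      simp [and_comm]
    rw [this]
    refine sum_congr rfl fun k hk => ?_
    obtain ⟨m, hm⟩ : ∃ m, N - k = m + 1 := ⟨N - k - 1, by have := mem_Ico.1 hk; omega⟩
    rw [hm, hlast, mul_sum]
    exact sum_congr rfl fun l hl =>
      weightTerm_concat e (ne_nil_of_mem_compositionLists (Nat.succ_ne_zero m) hl) k

/-- The claimed expansion of the barbell, with the two kinds of terms. -/
def barbellTerms (a c n : ℕ) : R :=
  (∑ l ∈ compositionLists n with a ≤ l.getLastD 0 ∧ c + 1 ≤ l.getD 0 0, weightTerm e l) +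
    ∑ l ∈ compositionLists n with a ≤ l.getLastD 0 ∧ l.getD 0 0 ≤ c ∧ c < l.getD 1 0,
      exchangeTerm e l

theorem sum_antisymm_eq_zero [Algebra ℚ R] (c : ℕ) (G : ℕ → ℕ → R)
    (hG : ∀ k < c, ∀ l < c, G k l = - G l k) :
    ∑ k ∈ range c, ∑ l ∈ range c, G k l = 0 := by
  suffices h : ∑ k ∈ range c, ∑ l ∈ range c, G k l = -∑ k ∈ range c, ∑ l ∈ range c, G k l by
    have : IsAddTorsionFree R := .of_module_rat R
    exact self_eq_neg.1 h
  conv_lhs => rw [sum_comm]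
  rw [← sum_neg_distrib]
  refine sum_congr rfl fun k hk => ?_
  rw [← sum_neg_distrib]
  exact sum_congr rfl fun l hl => hG l (mem_range.1 hl) k (mem_range.1 hk)

/-- The tails that may follow a part `l` such that the last part is at least `a`. -/
def lastBoundedTail (a l m : ℕ) : R :=
  ∑ J ∈ compositionLists m with a ≤ J.getLastD l, tailTerm e J

theorem lastBoundedTail_congr {a l l' m : ℕ} (h : m = 0 → a ≤ l ∧ a ≤ l') :
    lastBoundedTail e a l m = lastBoundedTail e a l' m := by
  rw [lastBoundedTail, lastBoundedTail]
  congr 1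
  refine filter_congr fun J hJ => ?_
  obtain rfl | hm := eq_or_ne m 0
  · obtain rfl : J = [] := by simpa [compositionLists_zero] using hJ
    simpa using iff_of_true (h rfl).1 (h rfl).2
  · obtain _ | ⟨j, J⟩ := J
    · exact absurd rfl (ne_nil_of_mem_compositionLists hm hJ)
    · rw [List.getLastD_cons, List.getLastD_cons]

theorem barbellTerms_eq [Algebra ℚ R] (α b c : ℕ) :
    barbellTerms e (α + 1) c (α + b + c + 1) = lollipopTerms e (α + 1) (α + b + c + 1) -
      ∑ k ∈ range c, k * e (k + 1) * lollipopTerms e (α + 1) (α + b + c - k) := by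
  set N := α + b + c with hN
  set a := α + 1 with ha
  -- The total is N+1, so parts k+1 and l+1 fit exactly when k+l < N; the guard excludes truncated
  -- subtractions.
  have hzero : ∑ k ∈ range c, ∑ l ∈ range c, (if k + l < N then
      ((l : R) - k) * e (k + 1) * e (l + 1) * lastBoundedTail e a (l + 1) (N - k - 1 - l)
      else 0) = 0 := by
    refine sum_antisymm_eq_zero c _ fun k hk l hl => ?_
    rw [add_comm l k]
    split_ifs with h
    -- An empty tail means k+l+1 = α+b+c; as k, l < c, both are then at least α, so either part may
    -- stand last.
    · rw [show N - l - 1 - k = N - k - 1 - l by omega,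
        lastBoundedTail_congr e (l := l + 1) (l' := k + 1) (fun h0 => by omega)]
      ring
    · simp
  -- The coefficient (k+1)l - k(l+1) = l-k is that of `exchangeTerm`, so second parts above c cancel
  -- and only l < c survives.
  have hinner : ∀ k ∈ range c, ∑ l ∈ range c, (if k + l < N then
      ((l : R) - k) * e (k + 1) * e (l + 1) * lastBoundedTail e a (l + 1) (N - k - 1 - l)
      else 0) =
      ∑ J ∈ compositionLists (N - k), ((if a ≤ J.getLastD (k + 1) then
        weightTerm e ((k + 1) :: J) else 0) -
        (if a ≤ J.getLastD (k + 1) ∧ c < J.getD 0 0 then exchangeTerm e ((k + 1) :: J) else 0) -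
        k * e (k + 1) * (if a ≤ J.getLastD 0 then weightTerm e J else 0)) := by
    intro k hk
    have hk := mem_range.1 hk
    obtain ⟨m, hm⟩ : ∃ m, N - k = m + 1 := ⟨N - k - 1, by omega⟩
    rw [hm, sum_compositionLists_cons]
    have hl : ∀ l ∈ range (m + 1), ∑ J ∈ compositionLists (m - l),
        ((if a ≤ ((l + 1) :: J).getLastD (k + 1) then
        weightTerm e ((k + 1) :: (l + 1) :: J) else 0) -
        (if a ≤ ((l + 1) :: J).getLastD (k + 1) ∧ c < ((l + 1) :: J).getD 0 0 then
          exchangeTerm e ((k + 1) :: (l + 1) :: J) else 0) -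
        k * e (k + 1) * (if a ≤ ((l + 1) :: J).getLastD 0 then weightTerm e ((l + 1) :: J) else 0))
        = if l < c then
          ((l : R) - k) * e (k + 1) * e (l + 1) * lastBoundedTail e a (l + 1) (m - l) else 0 := by
      intro l _
      split_ifs with hlc
      · rw [lastBoundedTail, sum_filter, mul_sum]
        refine sum_congr rfl fun J _ => ?_
        simp only [List.getLastD_cons, List.getD_cons_zero]
        split_ifs
        · omega
        · simp only [weightTerm, tailTerm_cons]
          push_cast
          ring
        · omega
        · simp
      · refine sum_eq_zero fun J _ => ?_
        simp only [List.getLastD_cons, List.getD_cons_zero]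
        split_ifs
        · simp only [weightTerm, exchangeTerm, tailTerm_cons]
          push_cast
          ring
        · omega
        · omega
        · simp
    rw [sum_congr rfl hl, ← sum_filter, ← sum_filter]
    have : (range c).filter (fun l => k + l < N) = (range (m + 1)).filter (· < c) := by
      ext l
      simp only [mem_filter, mem_range]
      omega
    rw [this]
    simp
  rw [sum_congr rfl hinner] at hzero
  simp only [sum_sub_distrib, ← mul_sum] at hzero
  rw [barbellTerms, lollipopTerms]
  simp only [lollipopTerms, sum_filter] at hzero ⊢
  simp only [sum_compositionLists_cons N]
  have hsplit : ∀ f : ℕ → R, ∑ k ∈ range (N + 1), f k =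
      ∑ k ∈ range c, f k + ∑ k ∈ Ico c (N + 1), f k := fun f =>
    (sum_range_add_sum_Ico f (by omega)).symm
  simp only [hsplit]
  have h1 : ∀ k ∈ range c, ∑ l ∈ compositionLists (N - k),
      (if a ≤ ((k + 1) :: l).getLastD 0 ∧ c + 1 ≤ ((k + 1) :: l).getD 0 0 then
        weightTerm e ((k + 1) :: l) else 0) = 0 := by
    intro k hk
    have hk := mem_range.1 hk
    refine sum_eq_zero fun l _ => if_neg ?_
    simp only [List.getD_cons_zero]
    omega
  have h2 : ∀ k ∈ Ico c (N + 1), ∑ l ∈ compositionLists (N - k),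
      (if a ≤ ((k + 1) :: l).getLastD 0 ∧ ((k + 1) :: l).getD 0 0 ≤ c ∧
        c < ((k + 1) :: l).getD 1 0 then exchangeTerm e ((k + 1) :: l) else 0) = 0 := by
    intro k hk
    have hk := (mem_Ico.1 hk).1
    refine sum_eq_zero fun l _ => if_neg ?_
    simp only [List.getD_cons_zero]
    omega
  have h3 : ∀ k ∈ Ico c (N + 1), ∑ l ∈ compositionLists (N - k),
      (if a ≤ ((k + 1) :: l).getLastD 0 ∧ c + 1 ≤ ((k + 1) :: l).getD 0 0 then
        weightTerm e ((k + 1) :: l) else 0) = ∑ l ∈ compositionLists (N - k),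
      (if a ≤ ((k + 1) :: l).getLastD 0 then weightTerm e ((k + 1) :: l) else 0) := by
    intro k hk
    have hk := (mem_Ico.1 hk).1
    refine sum_congr rfl fun l _ => ?_
    simp only [List.getD_cons_zero, show c + 1 ≤ k + 1 by omega, and_true]
  have h4 : ∀ k ∈ range c, ∑ l ∈ compositionLists (N - k),
      (if a ≤ ((k + 1) :: l).getLastD 0 ∧ ((k + 1) :: l).getD 0 0 ≤ c ∧
        c < ((k + 1) :: l).getD 1 0 then exchangeTerm e ((k + 1) :: l) else 0) =
      ∑ l ∈ compositionLists (N - k), (if a ≤ l.getLastD (k + 1) ∧ c < l.getD 0 0 then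
        exchangeTerm e ((k + 1) :: l) else 0) := by
    intro k hk
    have hk := mem_range.1 hk
    refine sum_congr rfl fun l _ => ?_
    simp only [List.getD_cons_zero, List.getLastD_cons, List.getD_cons_succ,
      show k + 1 ≤ c by omega, true_and]
  rw [sum_congr rfl h1, sum_congr rfl h2, sum_congr rfl h3, sum_congr rfl h4]
  simp only [List.getLastD_cons, sum_const_zero]
  linear_combination -hzero

/-- Three recursive properties of barbells determine their expansion. -/
theorem eq_barbellTerms_of_rec [Algebra ℚ R] (S : ℕ → ℕ → ℕ → R)
    (hsymm : ∀ α b c, S α b c = S c b α)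
    (hsucc : ∀ α b c, S α b (c + 1) = S α (b + 1) c - c * e (c + 1) * S α b 0)
    (hzero : ∀ α, S α 0 0 = (α + 1) * e (α + 1)) (α b c : ℕ) :
    S α b c = barbellTerms e (α + 1) c (α + b + c + 1) := by
  have hiter : ∀ c α b, S α b c =
      S α (b + c) 0 - ∑ k ∈ range c, k * e (k + 1) * S α (b + c - 1 - k) 0 := by
    intro c
    induction c with
    | zero => simp
    | succ c ih =>
      intro α b
      rw [hsucc, ih, sum_range_succ, show b + (c + 1) - 1 - c = b by omega,
        show b + 1 + c = b + (c + 1) by omega]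
      ring
  have hlolli : ∀ α m, S α m 0 = (m + α + 1) * e (m + α + 1) +
      ∑ k ∈ Ico α (m + α), k * e (k + 1) * S 0 (m + α - 1 - k) 0 := by
    intro α m
    -- Reading S α m 0 and S (m+α) 0 0 from the other end reduces both to the same path S 0 (m+α) 0,
    -- which the subtraction eliminates.
    have h1 := hiter α 0 m
    have h2 := hiter (m + α) 0 0
    rw [← hsymm] at h1
    rw [← hsymm, hzero] at h2
    rw [zero_add, ← sum_range_add_sum_Ico _ (Nat.le_add_left α m)] at h2
    push_cast at h2
    linear_combination h1 - h2
  have hpath : ∀ m, S 0 m 0 = lollipopTerms e 1 (m + 1) := by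
    intro m
    induction m using Nat.strong_induction_on with
    | _ m ih =>
      rw [hlolli, lollipopTerms_succ e 0 m (Nat.zero_le m)]
      simp only [add_zero, Nat.cast_zero]
      congr 1
      refine sum_congr rfl fun k hk => ?_
      have hk := (mem_Ico.1 hk).2
      rw [ih _ (by omega), show m - 1 - k + 1 = m - k by omega]
  have hlolli' : ∀ α m, S α m 0 = lollipopTerms e (α + 1) (m + α + 1) := by
    intro α m
    rw [hlolli, lollipopTerms_succ e α (m + α) (Nat.le_add_left α m)]
    push_cast
    congr 1
    refine sum_congr rfl fun k hk => ?_
    have hk := (mem_Ico.1 hk).2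
    rw [hpath, show m + α - 1 - k + 1 = m + α - k by omega]
  rw [barbellTerms_eq, hiter, hlolli', show b + c + α + 1 = α + b + c + 1 by omega]
  congr 1
  refine sum_congr rfl fun k hk => ?_
  have hk := mem_range.1 hk
  rw [hlolli', show b + c - 1 - k + α + 1 = α + b + c - k by omega]

end BarbellExpansion

/-! ### Counting colourings of a chain block by block -/

section ChainColorings

variable {ι R : Type*} [DecidableEq ι] [Fintype ι] [CommRing R]

/-- A family of colourings of the blocks of a chain is proper. -/
def IsProperChain {ι : Type*} (I : List ℕ) (κ : ∀ j : Fin I.length, Fin (I.get j) → ι) : Prop :=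
  (∀ j, Function.Injective (κ j)) ∧
    ∀ j j' : Fin I.length, (j : ℕ) + 1 = j' → ∀ t : Fin (I.get j), (t : ℕ) + 1 = I.get j →
      ∀ s, κ j t ≠ κ j' s

theorem forall_kChain_adj_iff {ι : Type*} (I : List ℕ) (κ : KChainVertex I → ι) :
    (∀ u v, (kChain I).Adj u v → κ u ≠ κ v) ↔ IsProperChain I fun j t => κ ⟨j, t⟩ := by
  constructor
  · refine fun h => ⟨fun j t s hts => ?_, fun j j' hj t ht s => ?_⟩
    · by_contra hne
      refine h ⟨j, t⟩ ⟨j, s⟩ ⟨?_, j, Or.inl rfl, Or.inl rfl⟩ hts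
      simpa using hne
    · refine h _ _ ⟨?_, j', Or.inr ⟨hj, ht⟩, Or.inl rfl⟩
      rintro heq
      have := congrArg (fun v : KChainVertex I => (v.1 : ℕ)) heq
      simp only at this
      omega
  · rintro ⟨hinj, hlast⟩ ⟨j, t⟩ ⟨j', s⟩ ⟨hne, i, hu, hv⟩
    rcases hu with hu | ⟨hu, ht⟩ <;> rcases hv with hv | ⟨hv, hs⟩ <;>
      simp only at hu hv
    · subst hu
      subst hv
      exact fun h => hne (by rw [hinj _ h])
    · subst hu
      exact (hlast _ _ hv s hs t).symm
    · subst hv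
      exact hlast _ _ hu t ht s
    -- Both vertices are the last vertex of the same block, hence equal.
    · obtain rfl : j = j' := Fin.ext (by omega)
      simp only at ht hs
      exact absurd (by rw [show t = s from Fin.ext (by omega)]) hne

theorem isProperChain_cons {ι : Type*} (k : ℕ) (I : List ℕ)
    (φ : Fin k → ι) (κ : ∀ j : Fin I.length, Fin (I.get j) → ι) :
    IsProperChain (k :: I)
        (Fin.cons (α := fun j : Fin (I.length + 1) => Fin ((k :: I).get j) → ι) φ κ) ↔
      Function.Injective φ ∧ IsProperChain I κ ∧
        ∀ j : Fin I.length, (j : ℕ) = 0 → ∀ s, ∀ t : Fin k, (t : ℕ) + 1 = k → φ t ≠ κ j s := by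
  constructor
  · rintro ⟨hinj, hlast⟩
    refine ⟨hinj 0, ⟨fun j => hinj j.succ, fun j j' hj => hlast j.succ j'.succ ?_⟩, ?_⟩
    · simpa using hj
    · exact fun j hj s t ht => hlast 0 j.succ (by simp [hj]) t ht s
  · rintro ⟨hφ, ⟨hinj, hlast⟩, h⟩
    refine ⟨fun j => Fin.cases hφ hinj j, fun j j' => ?_⟩
    refine Fin.cases ?_ (fun j => ?_) j <;> refine Fin.cases ?_ (fun j' => ?_) j'
    · intro hj
      simp at hj
    · exact fun hj t ht s => h j' (by simpa using hj.symm) s t ht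
    · intro hj
      simp at hj
    · exact fun hj => hlast j j' (by simpa using hj)

open Classical in
/-- The weighted number of proper colourings of a chain whose first block has colours in `s`. -/
noncomputable def chainSum (x : ι → R) (I : List ℕ) (s : Finset ι) : R :=
  ∑ κ : ∀ j : Fin I.length, Fin (I.get j) → ι,
    if IsProperChain I κ ∧ ∀ j : Fin I.length, (j : ℕ) = 0 → ∀ t, κ j t ∈ s then ∏ j, ∏ t, x (κ j t) else 0

open Classical in
/-- The weighted sum, over the injections of `k` points into `s`, of a function. -/
noncomputable def injectionSum (x : ι → R) (k : ℕ) (s : Finset ι) (F : (Fin k → ι) → R) : R :=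
  ∑ φ : Fin k → ι, if Function.Injective φ ∧ ∀ t, φ t ∈ s then (∏ t, x (φ t)) * F φ else 0

theorem chainSum_nil (x : ι → R) (s : Finset ι) : chainSum x [] s = 1 := by
  have h : IsProperChain (ι := ι) [] = fun _ => True := by
    funext κ
    exact eq_true ⟨fun j => j.elim0, fun j => j.elim0⟩
  simp [chainSum, h]

/-- Only the colour of the last vertex of a block restricts the next block; if k = 0 there is no
such vertex and no restriction. -/
theorem chainSum_cons (x : ι → R) (k : ℕ) (I : List ℕ) (s : Finset ι) :
    chainSum x (k :: I) s = injectionSum x k s fun φ =>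
      chainSum x I {i | ∀ t : Fin k, (t : ℕ) + 1 = k → φ t ≠ i} := by
  classical
  rw [chainSum]
  refine ((Fin.consEquiv fun j : Fin (I.length + 1) =>
    Fin ((k :: I).get j) → ι).sum_comp _).symm.trans ?_
  rw [Fintype.sum_prod_type, injectionSum]
  refine sum_congr rfl fun φ _ => ?_
  rw [chainSum]
  have hs : ∀ κ : ∀ j : Fin I.length, Fin (I.get j) → ι, (∀ j : Fin (k :: I).length, (j : ℕ) = 0 →
      ∀ t, Fin.cons (α := fun j : Fin (I.length + 1) => Fin ((k :: I).get j) → ι) φ κ j t ∈ s) ↔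
      ∀ t, φ t ∈ s := fun κ =>
    ⟨fun h => h 0 rfl, fun h j => Fin.cases (fun _ => h) (fun j hj => by simp at hj) j⟩
  have hp : ∀ κ : ∀ j : Fin I.length, Fin (I.get j) → ι, ∏ j : Fin (k :: I).length, ∏ t,
      x (Fin.cons (α := fun j : Fin (I.length + 1) => Fin ((k :: I).get j) → ι) φ κ j t) =
      (∏ t, x (φ t)) * ∏ j, ∏ t, x (κ j t) := fun κ => Fin.prod_univ_succ _
  simp only [Fin.consEquiv, Equiv.coe_fn_mk, hs, hp]
  split_ifs with h
  · rw [mul_sum]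
    refine sum_congr rfl fun κ _ => ?_
    rw [mul_ite, mul_zero]
    refine if_congr ?_ rfl rfl
    simp only [mem_filter, mem_univ, true_and]
    exact (and_congr_left' (isProperChain_cons k I φ κ)).trans
      ⟨fun hκ => hκ.1.2, fun hκ => ⟨⟨h.1, hκ⟩, h.2⟩⟩
  · exact sum_eq_zero fun κ _ => if_neg fun hκ =>
      h ⟨((isProperChain_cons k I φ κ).1 hκ.1).1, hκ.2⟩

theorem injectionSum_succ_last (x : ι → R) (k : ℕ) (s : Finset ι) (F : ι → R) :
    injectionSum x (k + 1) s (fun φ => F (φ (Fin.last k))) =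
      ∑ i ∈ s, x i * F i * injectionSum x k (s.erase i) fun _ => 1 := by
  classical
  rw [injectionSum, ← (Fin.snocEquiv fun _ : Fin (k + 1) => ι).sum_comp, Fintype.sum_prod_type,
    ← sum_filter_add_sum_filter_not univ (· ∈ s)]
  rw [sum_eq_zero (s := univ.filter (· ∉ s)), add_zero, filter_mem_eq_inter, univ_inter]
  · refine sum_congr rfl fun i hi => ?_
    rw [injectionSum, mul_sum]
    refine sum_congr rfl fun φ _ => ?_
    have h : (Function.Injective (Fin.snoc (α := fun _ => ι) φ i) ∧
        ∀ t, Fin.snoc (α := fun _ => ι) φ i t ∈ s) ↔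
        (Function.Injective φ ∧ ∀ t, φ t ∈ s.erase i) := by
      rw [Fin.snoc_injective_iff, Fin.forall_fin_succ']
      simp only [Fin.snoc_castSucc, Fin.snoc_last, mem_erase, Set.mem_range, not_exists, hi,
        and_true, forall_and, ne_eq]
      tauto
    simp only [Fin.snocEquiv, Equiv.coe_fn_mk, h, mul_ite, mul_zero, Fin.snoc_last]
    refine if_congr Iff.rfl ?_ rfl
    rw [Fin.prod_univ_castSucc]
    simp only [Fin.snoc_castSucc, Fin.snoc_last]
    ring
  · intro i hi
    have hi := (mem_filter.1 hi).2
    refine sum_eq_zero fun φ _ => if_neg fun h => hi ?_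
    simpa [Fin.snocEquiv] using h.2 (Fin.last k)

/-- Each k-subset of `s` is the image of k! injections; the induction removes the last point. -/
theorem injectionSum_one (x : ι → R) (k : ℕ) (s : Finset ι) :
    injectionSum x k s (fun _ => 1) = k.factorial * elemSymmOn x k s := by
  induction k generalizing s with
  | zero => simp [injectionSum, elemSymmOn_zero, Function.injective_of_subsingleton]
  | succ k ih =>
    rw [injectionSum_succ_last x k s fun _ => 1]
    simp only [ih, mul_one, Nat.factorial_succ]
    push_cast
    rw [mul_comm ((k : R) + 1), mul_assoc, ← sum_mul_elemSymmOn_erase, mul_sum]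
    exact sum_congr rfl fun i _ => by ring

theorem chainSum_succ_cons (x : ι → R) (k : ℕ) (I : List ℕ) (s : Finset ι) :
    chainSum x ((k + 1) :: I) s =
      k.factorial * ∑ i ∈ s, x i * elemSymmOn x k (s.erase i) * chainSum x I (univ.erase i) := by
  have h : ∀ φ : Fin (k + 1) → ι,
      ({i | ∀ t : Fin (k + 1), (t : ℕ) + 1 = k + 1 → φ t ≠ i} : Finset ι) =
        univ.erase (φ (Fin.last k)) := by
    intro φ
    ext i
    simp only [mem_filter, mem_univ, true_and, mem_erase, and_true]
    refine ⟨fun h => (h (Fin.last k) rfl).symm, fun h t ht => ?_⟩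
    rw [show t = Fin.last k from Fin.ext (by simpa using ht)]
    exact h.symm
  rw [chainSum_cons]
  simp only [h]
  rw [injectionSum_succ_last x k s fun i => chainSum x I (univ.erase i), mul_sum]
  refine sum_congr rfl fun i _ => ?_
  rw [injectionSum_one]
  ring

theorem chainSum_path (x : ι → R) (b c : ℕ) (i : ι) :
    chainSum x (List.replicate b 1 ++ [c]) (univ.erase i) =
      c.factorial * (transferStep x)^[b] (puncturedSum x c) i := by
  induction b generalizing i with
  | zero =>
    rw [List.replicate_zero, List.nil_append, chainSum_cons]
    simp only [chainSum_nil, injectionSum_one]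
    rfl
  | succ b ih =>
    rw [List.replicate_succ, List.cons_append, chainSum_succ_cons x 0,
      Function.iterate_succ_apply', transferStep, mul_sum, mul_sum]
    refine sum_congr rfl fun l _ => ?_
    rw [ih, elemSymmOn_zero, Nat.factorial_zero]
    push_cast
    ring

theorem chainSum_barbell (x : ι → R) (α b c : ℕ) :
    chainSum x ((α + 1) :: (List.replicate b 1 ++ [c])) univ =
      α.factorial * c.factorial * barbellSum x α b c := by
  rw [chainSum_succ_cons, barbellSum, mul_assoc, mul_sum _ _ (c.factorial : R)]
  congr 1
  refine sum_congr rfl fun i _ => ?_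
  rw [chainSum_path, puncturedSum]
  ring

open Classical in
theorem sum_coloring_eq_chainSum (x : ι → R) (I : List ℕ) :
    ∑ κ : KChainVertex I → ι,
      (if ∀ u v, (kChain I).Adj u v → κ u ≠ κ v then ∏ v, x (κ v) else 0) =
      chainSum x I univ := by
  rw [chainSum, ← (Equiv.piCurry fun (j : Fin I.length) (_ : Fin (I.get j)) => ι).sum_comp]
  refine sum_congr rfl fun κ _ => if_congr ?_ ?_ rfl
  · rw [forall_kChain_adj_iff]
    simp only [mem_univ, implies_true, and_true]
    rfl
  · rw [Fintype.prod_sigma]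
    rfl

end ChainColorings

/-! ### Reduction to finitely many variables -/

section Truncation

/-- Two power series have the same coefficients at the monomials in the variables in `s`. -/
def AgreeOn (s : Finset ℕ) (f g : MvPowerSeries ℕ ℚ) : Prop :=
  ∀ d : ℕ →₀ ℕ, d.support ⊆ s → MvPowerSeries.coeff d f = MvPowerSeries.coeff d g

namespace AgreeOn

variable {s : Finset ℕ} {f g f' g' : MvPowerSeries ℕ ℚ}

theorem refl (s : Finset ℕ) (f : MvPowerSeries ℕ ℚ) : AgreeOn s f f := fun _ _ => rfl

theorem add (h : AgreeOn s f g) (h' : AgreeOn s f' g') : AgreeOn s (f + f') (g + g') :=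
  fun d hd => by rw [map_add, map_add, h d hd, h' d hd]

/-- Every divisor of a monomial in the variables of `s` is again such a monomial. -/
theorem mul (h : AgreeOn s f g) (h' : AgreeOn s f' g') : AgreeOn s (f * f') (g * g') := by
  classical
  intro d hd
  rw [MvPowerSeries.coeff_mul, MvPowerSeries.coeff_mul]
  refine sum_congr rfl fun p hp => ?_
  have hp := mem_antidiagonal.1 hp
  rw [h p.1 ((Finsupp.support_mono (hp ▸ le_self_add)).trans hd),
    h' p.2 ((Finsupp.support_mono (hp ▸ le_add_self)).trans hd)]

theorem sum {α : Type*} (t : Finset α) {F G : α → MvPowerSeries ℕ ℚ}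
    (h : ∀ i ∈ t, AgreeOn s (F i) (G i)) : AgreeOn s (∑ i ∈ t, F i) (∑ i ∈ t, G i) :=
  fun d hd => by
    rw [map_sum, map_sum]
    exact sum_congr rfl fun i hi => h i hi d hd

end AgreeOn

variable {s : Finset ℕ} {e e' : ℕ → MvPowerSeries ℕ ℚ}

theorem AgreeOn.tailTerm (h : ∀ k, AgreeOn s (e k) (e' k)) (l : List ℕ) :
    AgreeOn s (tailTerm e l) (tailTerm e' l) := by
  induction l with
  | nil => exact .refl s _
  | cons i l ih =>
    rw [tailTerm_cons, tailTerm_cons]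
    exact ((AgreeOn.refl s _).mul (h i)).mul ih

theorem AgreeOn.weightTerm (h : ∀ k, AgreeOn s (e k) (e' k)) (l : List ℕ) :
    AgreeOn s (weightTerm e l) (weightTerm e' l) := by
  obtain _ | ⟨i, l⟩ := l
  · exact .refl s _
  · exact ((AgreeOn.refl s _).mul (h i)).mul (.tailTerm h l)

theorem AgreeOn.exchangeTerm (h : ∀ k, AgreeOn s (e k) (e' k)) (l : List ℕ) :
    AgreeOn s (exchangeTerm e l) (exchangeTerm e' l) := by
  obtain _ | ⟨i, _ | ⟨j, l⟩⟩ := l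
  · exact .refl s _
  · exact .refl s _
  · exact (((AgreeOn.refl s _).mul (h i)).mul (h j)).mul (.tailTerm h l)

theorem AgreeOn.barbellTerms (h : ∀ k, AgreeOn s (e k) (e' k)) (a c n : ℕ) :
    AgreeOn s (barbellTerms e a c n) (barbellTerms e' a c n) :=
  (AgreeOn.sum _ fun l _ => .weightTerm h l).add (AgreeOn.sum _ fun l _ => .exchangeTerm h l)

/-- The variables in `s`. -/
noncomputable def variablesOn (s : Finset ℕ) (i : s) : MvPowerSeries ℕ ℚ :=
  MvPowerSeries.X (i : ℕ)

theorem prod_X_eq_monomial {α : Type*} (t : Finset α) (f : α → ℕ) :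
    ∏ i ∈ t, (MvPowerSeries.X (f i) : MvPowerSeries ℕ ℚ) =
      MvPowerSeries.monomial (∑ i ∈ t, Finsupp.single (f i) 1) 1 := by
  classical
  induction t using Finset.induction_on with
  | empty => simp
  | insert i t hi ih =>
    rw [prod_insert hi, sum_insert hi, ih, MvPowerSeries.X, MvPowerSeries.monomial_mul_monomial,
      one_mul]

theorem elemSymmOn_univ_subtype (s : Finset ℕ) (k : ℕ) :
    elemSymmOn (variablesOn s) k univ =
      ∑ t ∈ s.powersetCard k, ∏ i ∈ t, (MvPowerSeries.X i : MvPowerSeries ℕ ℚ) := by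
  rw [elemSymmOn, ← esymm_map_val, ← esymm_map_val]
  congr 1
  have : s.val = (univ : Finset s).val.map Subtype.val := by
    simpa using (attach_val s ▸ (Multiset.attach_map_val s.val)).symm
  conv_rhs => rw [this]
  rw [Multiset.map_map]
  rfl

theorem sum_single_apply (t : Finset ℕ) (j : ℕ) :
    (∑ i ∈ t, Finsupp.single i 1 : ℕ →₀ ℕ) j = if j ∈ t then 1 else 0 := by
  rw [Finsupp.finsetSum_apply]
  simp [Finsupp.single_apply]

theorem agreeOn_elemSymm (s : Finset ℕ) (k : ℕ) :
    AgreeOn s (elemSymm k) (elemSymmOn (variablesOn s) k univ) := by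
  classical
  intro d hd
  rw [elemSymmOn_univ_subtype, map_sum]
  rw [sum_congr rfl fun t _ => by
    rw [show ∏ i ∈ t, (MvPowerSeries.X i : MvPowerSeries ℕ ℚ) =
      MvPowerSeries.monomial (∑ i ∈ t, Finsupp.single i 1) 1 from prod_X_eq_monomial t id,
      MvPowerSeries.coeff_monomial]]
  -- Only the support of a squarefree d yields the monomial x^d.
  have h : ∀ t : Finset ℕ, d = ∑ i ∈ t, Finsupp.single i 1 ↔ (∀ i, d i ≤ 1) ∧ t = d.support := by
    intro t
    constructor
    · rintro rfl
      refine ⟨fun i => ?_, ?_⟩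
      · rw [sum_single_apply]
        split_ifs <;> omega
      · ext i
        simp [sum_single_apply]
    · rintro ⟨h1, rfl⟩
      ext j
      rw [sum_single_apply]
      have := h1 j
      split_ifs with hj <;> rw [Finsupp.mem_support_iff] at hj <;> omega
  simp_rw [h]
  change (if (∀ i, d i ≤ 1) ∧ d.degree = k then (1 : ℚ) else 0) = _
  by_cases h1 : ∀ i, d i ≤ 1
  · have hdeg : d.degree = #d.support := by
      rw [Finsupp.degree_apply, card_eq_sum_ones]
      refine sum_congr rfl fun i hi => ?_
      have := h1 i
      have := Finsupp.mem_support_iff.1 hi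
      omega
    simp [h1, mem_powersetCard, hd, hdeg]
  · simp [h1]

-- A colouring with monomial x^d uses only colours in the support of d.
open Classical in
theorem coeff_chromaticSymm {V : Type*} [Fintype V] [DecidableEq V] (G : SimpleGraph V)
    (d : ℕ →₀ ℕ) :
    MvPowerSeries.coeff d (chromaticSymm G) = MvPowerSeries.coeff d (∑ κ : V → d.support,
      if ∀ u v, G.Adj u v → κ u ≠ κ v then ∏ v, variablesOn d.support (κ v) else 0) := by
  have hterm : ∀ κ : V → d.support, MvPowerSeries.coeff d
      (if ∀ u v, G.Adj u v → κ u ≠ κ v then ∏ v, variablesOn d.support (κ v) else 0) =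
      if (∀ u v, G.Adj u v → κ u ≠ κ v) ∧ ∑ v, Finsupp.single (κ v : ℕ) 1 = d then (1 : ℚ)
        else 0 := by
    intro κ
    simp only [variablesOn]
    split_ifs with h1 h2 h2
    · rw [prod_X_eq_monomial, MvPowerSeries.coeff_monomial, if_pos h2.2.symm]
    · rw [prod_X_eq_monomial, MvPowerSeries.coeff_monomial,
        if_neg fun h => h2 ⟨h1, h.symm⟩]
    · exact absurd h2.1 h1
    · exact map_zero _
  rw [map_sum, sum_congr rfl fun κ _ => hterm κ, sum_boole, ← Fintype.card_subtype,
    ← Nat.card_eq_fintype_card]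
  change ((Nat.card _ : ℕ) : ℚ) = _
  congr 1
  have hmem : ∀ κ : V → ℕ, ∑ v, Finsupp.single (κ v) 1 = d → ∀ v, κ v ∈ d.support := by
    rintro κ rfl v
    rw [Finsupp.mem_support_iff, Finsupp.finsetSum_apply]
    refine (Finset.sum_pos' (fun _ _ => Nat.zero_le _) ⟨v, mem_univ v, ?_⟩).ne'
    simp
  refine Nat.card_congr
    { toFun := fun κ => ⟨fun v => ⟨κ.1 v, hmem κ.1 κ.2 v⟩, fun u v h heq =>
        κ.1.valid h (congrArg Subtype.val heq), κ.2⟩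
      invFun := fun κ => ⟨SimpleGraph.Coloring.mk (fun v => (κ.1 v : ℕ)) fun {u v} h heq =>
        κ.2.1 u v h (Subtype.ext heq), κ.2.2⟩
      left_inv := fun κ => rfl
      right_inv := fun κ => rfl }

end Truncation

/-! ### Matching the statement with the list expansions -/

section Statement

theorem prodAfter_smul_eq_tailTerm (l : List ℕ) :
    ((l.map fun i : ℕ => (i : ℚ) - 1).prod) • (l.map elemSymm).prod = tailTerm elemSymm l := by
  induction l with
  | nil => simp [tailTerm]
  | cons i l ih =>
    rw [tailTerm_cons, ← ih]
    simp only [List.map_cons, List.prod_cons, Algebra.smul_def, map_mul, map_sub, map_natCast,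
      map_one]
    ring

/-- In `prodAfter` the list itself is coerced to rationals, through the list monad; here the cast
moves inside the map. -/
theorem prodAfter_eq {n : ℕ} (I : Composition n) (k : ℕ) :
    I.prodAfter k = ((I.blocks.drop k).map fun i : ℕ => (i : ℚ) - 1).prod := by
  rw [Composition.prodAfter, List.bind_eq_flatMap, show (fun a : ℕ => (pure (a : ℚ) : List ℚ)) = pure ∘ Nat.cast from rfl,
    List.flatMap_pure_eq_map, List.map_map]
  rfl

theorem weight_smul_elemSymm {n : ℕ} (I : Composition n) (hI : I.blocks ≠ []) :
    I.weight • I.elemSymm = weightTerm elemSymm I.blocks := by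
  rw [Composition.weight, Composition.elemSymm, Composition.part, prodAfter_eq]
  generalize I.blocks = B at hI ⊢
  obtain _ | ⟨i, l⟩ := B
  · exact absurd rfl hI
  · rw [weightTerm, ← prodAfter_smul_eq_tailTerm]
    simp only [Nat.sub_self, List.getD_cons_zero, List.drop_one, List.tail_cons, List.map_cons,
      List.prod_cons, Algebra.smul_def, map_mul, map_natCast]
    ring

theorem exchange_smul_elemSymm {n : ℕ} (I : Composition n) (hI : 0 < I.part 2) :
    (((I.part 2 : ℚ) - (I.part 1 : ℚ)) * I.prodAfter 2) • I.elemSymm =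
      exchangeTerm elemSymm I.blocks := by
  rw [Composition.part] at hI
  rw [Composition.elemSymm, Composition.part, Composition.part, prodAfter_eq]
  generalize I.blocks = B at hI ⊢
  obtain _ | ⟨i, _ | ⟨j, l⟩⟩ := B
  · simp at hI
  · simp at hI
  · rw [exchangeTerm, ← prodAfter_smul_eq_tailTerm]
    simp only [Nat.sub_self, Nat.add_one_sub_one, List.getD_cons_zero, List.getD_cons_succ,
      List.drop_succ_cons, List.drop_zero, List.map_cons, List.prod_cons, Algebra.smul_def,
      map_mul, map_sub, map_natCast]
    ring

theorem sum_composition_eq_barbellTerms (a c n : ℕ) (hn : n ≠ 0) :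
    (∑ I : Composition n with a ≤ I.lastPart ∧ c + 1 ≤ I.part 1, I.weight • I.elemSymm) +
      ∑ I : Composition n with a ≤ I.lastPart ∧ I.part 1 ≤ c ∧ c < I.part 2,
        (((I.part 2 : ℚ) - (I.part 1 : ℚ)) * I.prodAfter 2) • I.elemSymm =
      barbellTerms elemSymm a c n := by
  rw [barbellTerms, sum_filter _ (weightTerm _), sum_filter _ (exchangeTerm _),
    ← sum_composition, ← sum_composition, ← sum_filter, ← sum_filter]
  congr 1
  · refine sum_congr rfl fun I _ => weight_smul_elemSymm I fun h => hn ?_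
    rw [← I.blocks_sum, h, List.sum_nil]
  · refine sum_congr rfl fun I hI => exchange_smul_elemSymm I ?_
    exact (Nat.zero_le c).trans_lt (mem_filter.1 hI).2.2.2

end Statement

theorem mainTheorem4 (a b c n : ℕ) (ha : 1 ≤ a) (hn : n = a + b + c) :
    chromaticSymm (barbell a b c) =
      ((Nat.factorial (a - 1) : ℚ) * (Nat.factorial c : ℚ)) •
        ((∑ I : Composition n with a ≤ I.lastPart ∧ c + 1 ≤ I.part 1,
            I.weight • I.elemSymm) +
          ∑ I : Composition n with a ≤ I.lastPart ∧ I.part 1 ≤ c ∧ c < I.part 2,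
            (((I.part 2 : ℚ) - (I.part 1 : ℚ)) * I.prodAfter 2) • I.elemSymm) := by
  obtain ⟨α, rfl⟩ : ∃ α, a = α + 1 := ⟨a - 1, by omega⟩
  rw [sum_composition_eq_barbellTerms _ _ _ (by omega), Nat.add_sub_cancel]
  ext d
  rw [coeff_chromaticSymm, barbell, sum_coloring_eq_chainSum, chainSum_barbell,
    eq_barbellTerms_of_rec (fun k => elemSymmOn (variablesOn d.support) k univ)
      (barbellSum (variablesOn d.support)) (barbellSum_symm _) (barbellSum_succ _)
      (barbellSum_zero_zero _),
    show α + b + c + 1 = n by omega, map_smul, smul_eq_mul,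
    AgreeOn.barbellTerms (agreeOn_elemSymm d.support) (α + 1) c n d subset_rfl,
    ← MvPowerSeries.coeff_smul, Algebra.smul_def]
  simp only [map_mul, map_natCast]
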